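/- Let $1\le\xi<\omega_1$ be an ordinal. Then there is a partial injection $i:\omega^\omega\to\omega^\omega$ with disjoint domain and range whose graph $\mathrm{Gr}(i)=\{(x,i(x)) : x\in\mathrm{dom}(i)\}$ has the following properties, where $\omega^\omega$ carries the product of the discrete topologies. 1. $\mathrm{Gr}(i)=C\setminus D$ for some closed sets $C,D\subseteq\omega^\omega\times\omega^\omega$. 2. $\mathrm{Gr}(i)$ has a Borel $2$-coloring, i.e. there is a Borel map $c:\omega^\omega\to\{0,1\}$ with $c(x)\ne c(y)$ for all $(x,y)\in\mathrm{Gr}(i)$. 3. $\mathrm{Gr}(i)$ has no $\mathbf{\Delta}^0_\xi$-measurable countable coloring, i.e. there is no map $c:\omega^\omega\to\omega$ such that $c^{-1}(V)\in\mathbf{\Delta}^0_\xi$ for every $V\subseteq\omega$ and $c(x)\neq c(y)$ for all $(x,y)\in\mathrm{Gr}(i)$. Here $\mathbf{\Sigma}^0_1$ is the class of open sets; $\mathbf{\Sigma}^0_\xi$, for $\xi>1$, is the class of countable unions $\bigcup_n A_n$ where the complement of each $A_n$ is in $\mathbf{\Sigma}^0_{\eta_n}$ for some $1\le\eta_n<\xi$;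 and $\mathbf{\Delta}^0_\xi$ is the class of sets that are in $\mathbf{\Sigma}^0_\xi$ together with their complement. -/

import Mathlib

/-- `IsSigma0 ξ A`: the set `A` is in the additive Borel class `Σ⁰_ξ` of the space `X`.
`Σ⁰_1` consists of the open sets and, for `ξ > 1`, `Σ⁰_ξ` consists of the countable unions of sets
whose complements lie in classes `Σ⁰_η` with `1 ≤ η < ξ`. No set is in the class of index `0`. -/
inductive IsSigma0 {X : Type*} [TopologicalSpace X] : Ordinal.{0} → Set X → Prop
  | of_isOpen (U : Set X) (hU : IsOpen U) : IsSigma0 1 U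
  | iUnion (ξ : Ordinal.{0}) (hξ : 1 < ξ) (η : ℕ → Ordinal.{0}) (A : ℕ → Set X)
      (h_one : ∀ n, 1 ≤ η n) (h_lt : ∀ n, η n < ξ) (hA : ∀ n, IsSigma0 (η n) (A n)ᶜ) :
      IsSigma0 ξ (⋃ n, A n)

/-- The multiplicative Borel class `Π⁰_ξ`: complements of `Σ⁰_ξ` sets. -/
def IsPi0 {X : Type*} [TopologicalSpace X] (ξ : Ordinal.{0}) (A : Set X) : Prop :=
  IsSigma0 ξ Aᶜ

/-- The ambiguous Borel class `Δ⁰_ξ = Σ⁰_ξ ∩ Π⁰_ξ`. -/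
def IsDelta0 {X : Type*} [TopologicalSpace X] (ξ : Ordinal.{0}) (A : Set X) : Prop :=
  IsSigma0 ξ A ∧ IsPi0 ξ A

/-- A map is `Δ⁰_ξ`-measurable if the preimages of open sets are `Δ⁰_ξ`. -/
def IsDelta0Measurable {X Y : Type*} [TopologicalSpace X] [TopologicalSpace Y] (ξ : Ordinal.{0})
    (c : X → Y) : Prop :=
  ∀ V : Set Y, IsOpen V → IsDelta0 ξ (c ⁻¹' V)

/-- `c` is a coloring of the binary relation `B` on `X`. -/
def IsColoring {X K : Type*} (B : Set (X × X)) (c : X → K) : Prop :=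
  ∀ x y : X, (x, y) ∈ B → c x ≠ c y

/-- A partial map is a partial injection if it is injective on its domain. -/
def IsPartialInjection {X Y : Type*} (f : X →. Y) : Prop :=
  ∀ (x x' : X) (y : Y), y ∈ f x → y ∈ f x' → x = x'

/-! The proof diagonalises through a Borel universal set. Points are pairs (e, x), via
`bairePairing`, and e codes countably many Σ⁰_ξ sets. The colour classes of a Δ⁰_ξ-measurable
coloring would all be coded by one e, so it suffices to join two points of the same coded set in
every section which those sets cover (`exists_graph_joining_points`). Sections have the Baire
property, so some coded set is comeagre in a basic neighbourhood. Two generic points f e, g e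
sharing the stem of that neighbourhood, continued by 0 and by 1, both lie in the set. The entry
after the stem gives the Borel 2-coloring.

The delicate point is the complexity of the graph, since the choice of stem and extensions is only
Borel in e. It is therefore coded in a map r with closed graph (`exists_isClosed_graph_unpair`), and
the generic points are built so as to record r e as well. If such pairs converge to distinct limits,
then r e converges to some ρ from which the limits are built (`exists_limit_of_points`), and the
closed graph identifies ρ with the value of r at the limit parameter. Hence the edges together with
the diagonal form a closed set, and removing the diagonal gives C \ D. -/

/-- The finite sequence of the first `n` values of `x`. -/
def initialSegment (x : ℕ → ℕ) (n : ℕ) : List ℕ := (List.range n).map x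

@[simp] theorem length_initialSegment (x : ℕ → ℕ) (n : ℕ) : (initialSegment x n).length = n := by
  simp [initialSegment]

theorem getElem?_initialSegment (x : ℕ → ℕ) {n i : ℕ} (h : i < n) :
    (initialSegment x n)[i]? = some (x i) := by
  simp [initialSegment, h]

theorem initialSegment_add (x : ℕ → ℕ) (m k : ℕ) :
    ∃ t, initialSegment x (m + k) = initialSegment x m ++ t := by
  refine ⟨((List.range k).map (m + ·)).map x, ?_⟩
  rw [initialSegment, List.range_add, List.map_append]
  rfl

theorem initialSegment_congr {x y : ℕ → ℕ} {n : ℕ} (h : ∀ i < n, x i = y i) :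
    initialSegment x n = initialSegment y n := by
  simp only [initialSegment, List.map_inj_left, List.mem_range]
  exact h

/-! ### Baire property, uniformly in a parameter -/

/-- `A ⊆ E × (ℕ → ℕ)` has the Baire property measurably in the parameter: there are measurable
families `O j` of dense open sets and `W` of open sets, given by basic neighbourhoods, such that
`A` and `W` coincide on the intersection of the `O j`. -/
def HasUniformBaireProperty {E : Type*} [MeasurableSpace E] (A : Set (E × (ℕ → ℕ))) : Prop :=
  ∃ (W : List ℕ → Set E) (O : ℕ → List ℕ → Set E),
    (∀ s, MeasurableSet (W s)) ∧ (∀ j s, MeasurableSet (O j s)) ∧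
    (∀ s t, W s ⊆ W (s ++ t)) ∧ (∀ j e s, ∃ t, e ∈ O j (s ++ t)) ∧
    ∀ e x, (∀ j, ∃ n, e ∈ O j (initialSegment x n)) →
      ((e, x) ∈ A ↔ ∃ n, e ∈ W (initialSegment x n))

/-- The exterior of the open set `W` approximates the complement. Requirement 0 is the new dense
open set, `W` together with its exterior; the old requirements are kept as they are. -/
theorem HasUniformBaireProperty.compl {E : Type*} [MeasurableSpace E] {A : Set (E × (ℕ → ℕ))}
    (h : HasUniformBaireProperty A) : HasUniformBaireProperty Aᶜ := by
  obtain ⟨W, O, hW, hO, hup, hd, hA⟩ := h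
  have hW' : ∀ s, MeasurableSet (⋂ t, (W (s ++ t))ᶜ) := fun s =>
    MeasurableSet.iInter fun t => (hW _).compl
  refine ⟨fun s => ⋂ t, (W (s ++ t))ᶜ,
    fun j s => j.casesOn (W s ∪ ⋂ t, (W (s ++ t))ᶜ) (fun j => O j s), hW', ?_, ?_, ?_, ?_⟩
  · rintro (_ | j) s
    · exact (hW s).union (hW' s)
    · exact hO j s
  · intro s t e he
    simp only [Set.mem_iInter, Set.mem_compl_iff, List.append_assoc] at he ⊢
    exact fun t' => he _
  · rintro (_ | j) e s
    · by_cases h : ∃ t, e ∈ W (s ++ t)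
      · obtain ⟨t, ht⟩ := h
        exact ⟨t, Or.inl ht⟩
      · refine ⟨[], Or.inr ?_⟩
        simpa using h
    · exact hd j e s
  · intro e x hx
    have hA' := hA e x fun j => hx (j + 1)
    rw [Set.mem_compl_iff, hA']
    constructor
    · intro h
      obtain ⟨n, hn⟩ := hx 0
      rcases hn with hn | hn
      · exact absurd ⟨n, hn⟩ h
      · exact ⟨n, hn⟩
    · rintro ⟨n, hn⟩ ⟨m, hm⟩
      simp only [Set.mem_iInter, Set.mem_compl_iff] at hn
      rcases le_total n m with h | h
      · obtain ⟨k, rfl⟩ := Nat.exists_eq_add_of_le h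
        obtain ⟨t, ht⟩ := initialSegment_add x n k
        exact hn t (ht ▸ hm)
      · obtain ⟨k, rfl⟩ := Nat.exists_eq_add_of_le h
        obtain ⟨t, ht⟩ := initialSegment_add x m k
        refine hn [] ?_
        rw [List.append_nil, ht]
        exact hup _ _ hm

theorem HasUniformBaireProperty.iUnion {E : Type*} [MeasurableSpace E]
    {A : ℕ → Set (E × (ℕ → ℕ))} (h : ∀ k, HasUniformBaireProperty (A k)) :
    HasUniformBaireProperty (⋃ k, A k) := by
  choose W O hW hO hup hd hA using h
  refine ⟨fun s => ⋃ k, W k s, fun j s => O j.unpair.1 j.unpair.2 s,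
    fun s => MeasurableSet.iUnion fun k => hW k s, fun j s => hO _ _ s,
    fun s t => Set.iUnion_mono fun k => hup k s t, fun j e s => hd _ _ e s, ?_⟩
  intro e x hx
  have h : ∀ k, (e, x) ∈ A k ↔ ∃ n, e ∈ W k (initialSegment x n) := fun k =>
    hA k e x fun j => by simpa using hx (Nat.pair k j)
  simp only [Set.mem_iUnion, h]
  exact exists_comm

/-- The σ-algebra of sets with the uniform Baire property. -/
@[reducible]
def uniformBaireMeasurableSpace (E : Type*) [MeasurableSpace E] :
    MeasurableSpace (E × (ℕ → ℕ)) where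
  MeasurableSet' := HasUniformBaireProperty
  measurableSet_empty := ⟨fun _ => ∅, fun _ _ => Set.univ, by simp, by simp, by simp, by simp,
    by simp⟩
  measurableSet_compl _ h := h.compl
  measurableSet_iUnion _ h := HasUniformBaireProperty.iUnion h

theorem MeasurableSet.hasUniformBaireProperty {E : Type*} [MeasurableSpace E]
    {A : Set (E × (ℕ → ℕ))} (hA : MeasurableSet A) : HasUniformBaireProperty A := by
  have key : (Prod.instMeasurableSpace : MeasurableSpace (E × (ℕ → ℕ))) ≤
      uniformBaireMeasurableSpace E := by
    refine sup_le ?_ ?_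
    · rintro _ ⟨B, hB, rfl⟩
      exact ⟨fun _ => B, fun _ _ => Set.univ, fun _ => hB, by simp, fun _ _ => subset_rfl,
        by simp, by simp⟩
    · rw [← measurable_iff_comap_le]
      refine (@measurable_pi_iff _ _ _ (uniformBaireMeasurableSpace E) _ _).2 fun i => ?_
      refine @measurable_to_countable' _ _ _ _ (uniformBaireMeasurableSpace E) _ fun v => ?_
      refine ⟨fun s => {_e | s[i]? = some v}, fun _ s => {_e | i < s.length}, ?_, ?_, ?_, ?_, ?_⟩
      · exact fun s => MeasurableSet.const _
      · exact fun j s => MeasurableSet.const _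
      · intro s t e he
        obtain ⟨h, -⟩ := List.getElem?_eq_some_iff.1 he
        simpa [List.getElem?_append_left h] using he
      · intro j e s
        refine ⟨List.replicate (i + 1) 0, ?_⟩
        simp only [Set.mem_ofPred_eq, List.length_append, List.length_replicate]
        omega
      · intro e x _
        simp only [Set.mem_preimage, Set.mem_singleton_iff, Set.mem_ofPred_eq]
        constructor
        · rintro h
          exact ⟨i + 1, by rw [getElem?_initialSegment x (Nat.lt_succ_self i), h]⟩
        · rintro ⟨n, hn⟩
          obtain ⟨h, -⟩ := List.getElem?_eq_some_iff.1 hn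
          rw [length_initialSegment] at h
          rw [getElem?_initialSegment x h] at hn
          exact Option.some_injective _ hn
  exact key A hA

/-! ### Borel universal sets for the classes Σ⁰_ξ -/

/-- A set `U` is universal for a family of sets if every member of the family is a section. -/
def IsUniversalFor {E Z : Type*} (U : Set (E × Z)) (F : Set Z → Prop) : Prop :=
  ∀ A, F A → ∃ e, A = {z | (e, z) ∈ U}

theorem exists_measurableSet_isUniversalFor_isOpen :
    ∃ U : Set ((ℕ → ℕ) × (ℕ → ℕ)), MeasurableSet U ∧ IsUniversalFor U IsOpen := by
  obtain ⟨B, hBc, -, hB⟩ := TopologicalSpace.exists_countable_basis (ℕ → ℕ)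
  obtain ⟨V, hV⟩ : ∃ V : ℕ → Set (ℕ → ℕ), B ∪ {∅} = Set.range V :=
    (hBc.union (Set.countable_singleton ∅)).exists_eq_range ⟨∅, Or.inr rfl⟩
  have hVo : ∀ n, IsOpen (V n) := fun n => by
    have : V n ∈ B ∪ {∅} := hV ▸ Set.mem_range_self n
    rcases this with h | h
    · exact hB.isOpen h
    · rw [Set.mem_singleton_iff.1 h]
      exact isOpen_empty
  refine ⟨⋃ n, {q | q.1 n = 1} ∩ {q | q.2 ∈ V n}, ?_, ?_⟩
  · refine MeasurableSet.iUnion fun n => MeasurableSet.inter ?_ ?_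
    · exact ((measurable_pi_apply n).comp measurable_fst) (measurableSet_singleton 1)
    · exact measurable_snd (hVo n).measurableSet
  · intro A hA
    classical
    refine ⟨fun n => if V n ⊆ A then 1 else 0, ?_⟩
    ext z
    simp only [Set.mem_iUnion, Set.mem_inter_iff, Set.mem_ofPred_eq]
    constructor
    · intro hz
      obtain ⟨v, hv, hzv, hvA⟩ := hB.exists_subset_of_mem_open hz hA
      have : v ∈ Set.range V := hV ▸ Or.inl hv
      obtain ⟨n, rfl⟩ := this
      exact ⟨n, if_pos hvA, hzv⟩
    · rintro ⟨n, hn, hz⟩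
      by_contra hA'
      exact one_ne_zero (hn.symm.trans (if_neg fun h => hA' (h hz)))

theorem countable_Iio_of_lt_omega_one {ξ : Ordinal.{0}} (h : ξ < Ordinal.omega 1) :
    (Set.Iio ξ).Countable := by
  rw [← Cardinal.le_aleph0_iff_set_countable, Cardinal.mk_Iio_ordinal, Cardinal.lift_le_aleph0,
    ← Cardinal.lt_aleph_one_iff]
  rwa [← Cardinal.ord_aleph, Cardinal.lt_ord] at h

theorem IsSigma0.one_le {X : Type*} [TopologicalSpace X] {ξ : Ordinal.{0}} {A : Set X}
    (h : IsSigma0 ξ A) : 1 ≤ ξ := by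
  cases h with
  | of_isOpen => exact le_rfl
  | iUnion _ hξ => exact hξ.le

/-- Only countably many classes lie below ξ, so a single code can list, for every n, the index of a
lower class (entry `Nat.pair n 0`) and a code in that class for the complement of the n-th set
(entries `Nat.pair n (k + 1)`). -/
theorem exists_measurableSet_isUniversalFor_isSigma0 {ξ : Ordinal.{0}}
    (h : ξ < Ordinal.omega 1) :
    ∃ U : Set ((ℕ → ℕ) × (ℕ → ℕ)), MeasurableSet U ∧ IsUniversalFor U (IsSigma0 ξ) := by
  induction ξ using WellFoundedLT.induction with
  | ind ξ ih =>
  rcases eq_or_ne ξ 0 with rfl | h0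
  · refine ⟨∅, MeasurableSet.empty, fun A hA => ?_⟩
    exact absurd hA.one_le (not_le.2 zero_lt_one)
  obtain ⟨η, hη⟩ := (countable_Iio_of_lt_omega_one h).exists_eq_range
    ⟨0, pos_iff_ne_zero.2 h0⟩
  have hlt : ∀ m, η m < ξ := fun m => by
    have : η m ∈ Set.Iio ξ := hη ▸ Set.mem_range_self m
    exact this
  choose U hU hUu using fun m => ih (η m) (hlt m) ((hlt m).trans h)
  obtain ⟨V, hV, hVu⟩ := exists_measurableSet_isUniversalFor_isOpen
  rcases eq_or_ne ξ 1 with rfl | h1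
  · refine ⟨V, hV, fun A hA => ?_⟩
    cases hA with
    | of_isOpen _ hA => exact hVu A hA
    | iUnion _ hξ => exact absurd hξ (lt_irrefl _)
  refine ⟨⋃ (n : ℕ) (m : ℕ), {q | q.1 (Nat.pair n 0) = m} ∩
    {q | ((fun k => q.1 (Nat.pair n (k + 1))), q.2) ∈ U m}ᶜ, ?_, ?_⟩
  · refine MeasurableSet.iUnion fun n => MeasurableSet.iUnion fun m => MeasurableSet.inter ?_ ?_
    · exact measurableSet_eq_fun ((measurable_pi_apply (Nat.pair n 0)).comp measurable_fst)
        measurable_const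
    · refine (Measurable.prodMk (measurable_pi_lambda _ fun k => ?_) measurable_snd
        (hU m)).compl
      exact (measurable_pi_apply _).comp measurable_fst
  · intro A hA
    cases hA with
    | of_isOpen => exact absurd rfl h1
    | iUnion _ _ θ A _ hθ hA =>
    have hm : ∀ n, ∃ m, η m = θ n := fun n => by
      have : θ n ∈ Set.Iio ξ := hθ n
      rwa [hη] at this
    choose m hm using hm
    have he : ∀ n, ∃ e, (A n)ᶜ = {z | (e, z) ∈ U (m n)} := fun n =>
      hUu (m n) _ (by simpa only [hm n] using hA n)
    choose e he using he
    refine ⟨fun i => Nat.casesOn i.unpair.2 (m i.unpair.1) (e i.unpair.1), ?_⟩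
    ext z
    simp only [Set.mem_iUnion, Set.mem_inter_iff, Set.mem_ofPred_eq, Set.mem_compl_iff,
      Nat.unpair_pair, exists_eq_left']
    refine exists_congr fun n => ?_
    have := congrArg (z ∈ ·) (he n)
    simp only [Set.mem_compl_iff, Set.mem_ofPred_eq, eq_iff_iff] at this
    rw [← not_not (a := z ∈ A n), this]
    rfl

/-! ### Coding Borel maps by maps with closed graph -/

/-- A set `B` is decided by a closed graph if some map with closed graph reduces `B` to a clopen
condition on that graph. -/
def IsDecidedByClosedGraph {E : Type*} [TopologicalSpace E] (B : Set E) : Prop :=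
  ∃ (b : E → ℕ → ℕ) (K : Set (E × (ℕ → ℕ))),
    IsClosed {q : E × (ℕ → ℕ) | q.2 = b q.1} ∧ IsClopen K ∧ ∀ e, e ∈ B ↔ (e, b e) ∈ K

theorem IsClopen.isDecidedByClosedGraph {E : Type*} [TopologicalSpace E] {B : Set E}
    (h : IsClopen B) : IsDecidedByClosedGraph B :=
  ⟨fun _ _ => 0, Prod.fst ⁻¹' B, isClosed_eq continuous_snd continuous_const,
    h.preimage continuous_fst, fun _ => Iff.rfl⟩

theorem IsDecidedByClosedGraph.compl {E : Type*} [TopologicalSpace E] {B : Set E}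
    (h : IsDecidedByClosedGraph B) : IsDecidedByClosedGraph Bᶜ := by
  obtain ⟨b, K, hb, hK, h⟩ := h
  exact ⟨b, Kᶜ, hb, hK.compl, fun e => by simp [h]⟩

/-- The new map records all the witnesses `b n e`, and at 0 the least n with `e ∈ B n`, shifted by
one so that 0 means that there is none. Once the witnesses are correct, each `e ∈ B n` is a clopen
condition on them, so correctness of the entry at 0 is a closed condition. -/
theorem IsDecidedByClosedGraph.iUnion {E : Type*} [TopologicalSpace E] {B : ℕ → Set E}
    (h : ∀ n, IsDecidedByClosedGraph (B n)) : IsDecidedByClosedGraph (⋃ n, B n) := by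
  classical
  choose b K hb hK h using h
  let m : E → ℕ := fun e => if he : ∃ n, e ∈ B n then Nat.find he + 1 else 0
  have hm : ∀ e k, k = m e ↔ (k = 0 → ∀ n, e ∉ B n) ∧
      (∀ n, k = n + 1 → e ∈ B n ∧ ∀ i < n, e ∉ B i) := by
    intro e k
    by_cases he : ∃ n, e ∈ B n
    · simp only [m, dif_pos he]
      rcases k with _ | k
      · simpa using he
      · simp [eq_comm (a := k), Nat.find_eq_iff]
    · simp only [m, dif_neg he]
      push Not at he
      rcases k with _ | k <;> simp [he]
  let c : E → ℕ → ℕ := fun e i =>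
    Nat.casesOn i (m e) fun i => b i.unpair.1 e i.unpair.2
  have hc : ∀ (q : E × (ℕ → ℕ)), q.2 = c q.1 ↔
      (∀ n, (fun k => q.2 (Nat.pair n k + 1)) = b n q.1) ∧
      ((q.2 0 = 0 → ∀ n, (q.1, fun k => q.2 (Nat.pair n k + 1)) ∉ K n) ∧
      (∀ n, q.2 0 = n + 1 → (q.1, fun k => q.2 (Nat.pair n k + 1)) ∈ K n ∧
        ∀ i < n, (q.1, fun k => q.2 (Nat.pair i k + 1)) ∉ K i)) := by
    rintro ⟨e, β⟩
    have h1 : β = c e ↔ (∀ n, (fun k => β (Nat.pair n k + 1)) = b n e) ∧ β 0 = m e := by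
      constructor
      · rintro rfl
        exact ⟨fun n => by ext k; simp [c], rfl⟩
      · rintro ⟨hβ, h0⟩
        ext i
        rcases i with _ | i
        · exact h0
        · simpa [c] using congrFun (hβ i.unpair.1) i.unpair.2
    rw [h1, hm]
    refine and_congr_right fun hβ => ?_
    simp only [hβ, h]
  refine ⟨c, {q | q.2 0 ≠ 0}, ?_, ?_, ?_⟩
  · simp only [hc]
    have hcont : ∀ n, Continuous fun q : E × (ℕ → ℕ) =>
        (q.1, fun k => q.2 (Nat.pair n k + 1)) := fun n => by fun_prop
    have hv : ∀ v, IsOpen {q : E × (ℕ → ℕ) | q.2 0 = v} := fun v =>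
      (isOpen_discrete {v}).preimage (by fun_prop : Continuous fun q : E × (ℕ → ℕ) => q.2 0)
    have hK' := fun n => (hK n).preimage (hcont n)
    simp only [Set.ofPred_and, Set.ofPred_forall]
    refine (isClosed_iInter fun n => (hb n).preimage (hcont n)).inter (IsClosed.inter ?_ ?_)
    · exact isClosed_imp (hv 0)
        (by rw [Set.ofPred_forall]; exact isClosed_iInter fun n => (hK' n).compl.isClosed)
    · refine isClosed_iInter fun n => isClosed_imp (hv _) ((hK' n).isClosed.inter ?_)
      change IsClosed {q : E × (ℕ → ℕ) | ∀ i, i < n → _}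
      simp only [Set.ofPred_forall]
      exact isClosed_iInter fun i => isClosed_iInter fun _ => (hK' i).compl.isClosed
  · exact (isClopen_discrete ({0}ᶜ : Set ℕ)).preimage
      (by fun_prop : Continuous fun q : E × (ℕ → ℕ) => q.2 0)
  · intro e
    simp only [Set.mem_iUnion, Set.mem_ofPred_eq, c, m]
    split_ifs with he <;> simpa using he

/-- The σ-algebra of sets decided by a closed graph. -/
@[reducible]
def closedGraphMeasurableSpace (E : Type*) [TopologicalSpace E] : MeasurableSpace E where
  MeasurableSet' := IsDecidedByClosedGraph
  measurableSet_empty := isClopen_empty.isDecidedByClosedGraph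
  measurableSet_compl _ h := h.compl
  measurableSet_iUnion _ h := IsDecidedByClosedGraph.iUnion h

theorem MeasurableSet.isDecidedByClosedGraph {B : Set (ℕ → ℕ)} (hB : MeasurableSet B) :
    IsDecidedByClosedGraph B := by
  have key : (MeasurableSpace.pi : MeasurableSpace (ℕ → ℕ)) ≤
      closedGraphMeasurableSpace (ℕ → ℕ) := by
    refine iSup_le fun i => ?_
    rw [← measurable_iff_comap_le]
    refine @measurable_to_countable' _ _ _ _ (closedGraphMeasurableSpace _) _ fun v => ?_
    exact ((isClopen_discrete {v}).preimage (continuous_apply i)).isDecidedByClosedGraph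
  exact key B hB

/-- Every Borel map is coded in a map with closed graph. -/
theorem exists_isClosed_graph_unpair {g : (ℕ → ℕ) → ℕ → ℕ} (hg : Measurable g) :
    ∃ r : (ℕ → ℕ) → ℕ → ℕ, IsClosed {q : (ℕ → ℕ) × (ℕ → ℕ) | q.2 = r q.1} ∧
      ∀ e n, (r e n).unpair.1 = g e n := by
  have hB : ∀ i v, MeasurableSet {e | g e i = v} := fun i v =>
    ((measurable_pi_apply i).comp hg) (measurableSet_singleton v)
  choose b K hb hK h using fun i v => (hB i v).isDecidedByClosedGraph
  -- The second components carry the witnesses for all the sets {g e i = v}; these make the truth of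
  -- the first components a closed condition.
  let a : (ℕ → ℕ) → ℕ → ℕ := fun e n =>
    b n.unpair.1 n.unpair.2.unpair.1 e n.unpair.2.unpair.2
  let r : (ℕ → ℕ) → ℕ → ℕ := fun e n => Nat.pair (g e n) (a e n)
  have hr : ∀ q : (ℕ → ℕ) × (ℕ → ℕ), q.2 = r q.1 ↔ ∀ i v,
      (fun k => (q.2 (Nat.pair i (Nat.pair v k))).unpair.2) = b i v q.1 ∧
      ((q.2 i).unpair.1 = v ↔
        (q.1, fun k => (q.2 (Nat.pair i (Nat.pair v k))).unpair.2) ∈ K i v) := by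
    rintro ⟨e, β⟩
    constructor
    · rintro h'
      obtain rfl : β = r e := h'
      intro i v
      have : (fun k => (r e (Nat.pair i (Nat.pair v k))).unpair.2) = b i v e := by
        ext k
        simp [r, a]
      refine ⟨this, ?_⟩
      simp only [this, ← h]
      simp [r]
    · intro h'
      have h1 : ∀ i, (β i).unpair.1 = g e i := by
        intro i
        rw [(h' i (g e i)).2, (h' i (g e i)).1, ← h]
        rfl
      have h2 : ∀ i, (β i).unpair.2 = a e i := by
        intro i
        have := congrFun (h' i.unpair.1 i.unpair.2.unpair.1).1 i.unpair.2.unpair.2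
        simpa using this
      ext i
      simp only [r, ← h1, ← h2, Nat.pair_unpair]
  refine ⟨r, ?_, fun e n => by simp [r]⟩
  simp only [hr, Set.ofPred_forall]
  refine isClosed_iInter fun i => isClosed_iInter fun v => ?_
  have hcont : Continuous fun q : (ℕ → ℕ) × (ℕ → ℕ) =>
      (q.1, fun k => (q.2 (Nat.pair i (Nat.pair v k))).unpair.2) := by
    refine continuous_fst.prodMk (continuous_pi fun k => ?_)
    exact (continuous_of_discreteTopology (f := fun n : ℕ => n.unpair.2)).comp
      ((continuous_apply _).comp continuous_snd)
  have hv : IsClopen {q : (ℕ → ℕ) × (ℕ → ℕ) | (q.2 i).unpair.1 = v} :=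
    (isClopen_discrete {n : ℕ | n.unpair.1 = v}).preimage
      ((continuous_apply i).comp continuous_snd)
  have hK' := (hK i v).preimage hcont
  refine ((hb i v).preimage hcont).inter ?_
  simp only [iff_def]
  exact (isClosed_imp hv.isOpen hK'.isClosed).inter (isClosed_imp hK'.isOpen hv.isClosed)

/-! ### A pair of generic sequences recording r -/

/-- The sequence with the given initial segments, for an increasing chain of lists. -/
def limitOfLists (s : ℕ → List ℕ) (i : ℕ) : ℕ := (s (i + 1))[i]?.getD 0

theorem eq_initialSegment_limitOfLists {s : ℕ → List ℕ} (hs : ∀ n, ∃ a t, s (n + 1) = s n ++ a :: t)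
    (n : ℕ) : s n = initialSegment (limitOfLists s) (s n).length := by
  -- Every step adds an entry, so the default value in `limitOfLists` is never used.
  have hlen : ∀ n, n ≤ (s n).length := by
    intro n
    induction n with
    | zero => exact Nat.zero_le _
    | succ n ih =>
      obtain ⟨a, t, h⟩ := hs n
      simp only [h, List.length_append, List.length_cons]
      omega
  have hpre : ∀ n k, s n <+: s (n + k) := by
    intro n k
    induction k with
    | zero => exact List.prefix_rfl
    | succ k ih =>
      obtain ⟨a, t, h⟩ := hs (n + k)
      exact ih.trans ⟨a :: t, h.symm⟩
  refine List.ext_getElem? fun i => ?_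
  rcases lt_or_ge i (s n).length with hi | hi
  · rw [getElem?_initialSegment _ hi, limitOfLists]
    have hi' : i < (s (i + 1)).length := hlen (i + 1)
    rcases le_total n (i + 1) with h | h
    · obtain ⟨k, hk⟩ := Nat.exists_eq_add_of_le h
      obtain ⟨t, ht⟩ := hpre n k
      rw [hk, ← ht, List.getElem?_append_left hi, List.getElem?_eq_getElem hi]
      rfl
    · obtain ⟨k, hk⟩ := Nat.exists_eq_add_of_le h
      obtain ⟨t, ht⟩ := hpre (i + 1) k
      rw [hk, ← ht, List.getElem?_append_left hi', List.getElem?_eq_getElem hi']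
      rfl
  · rw [List.getElem?_eq_none hi, List.getElem?_eq_none (by simpa using hi)]

theorem apply_of_append_cons_eq_initialSegment {x : ℕ → ℕ} {s t : List ℕ} {a n : ℕ}
    (h : s ++ a :: t = initialSegment x n) : x s.length = a := by
  have hlen : s.length < n := by
    have := congrArg List.length h
    simp only [List.length_append, List.length_cons, length_initialSegment] at this
    omega
  have := getElem?_initialSegment x hlen
  rw [← h] at this
  simpa using this.symm

theorem eq_initialSegment_of_append {x : ℕ → ℕ} {s t : List ℕ} {n : ℕ}
    (h : s ++ t = initialSegment x n) : s = initialSegment x s.length := by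
  have hlen : n = s.length + t.length := by simpa using (congrArg List.length h).symm
  obtain ⟨t', ht'⟩ := initialSegment_add x s.length t.length
  rw [hlen, ht'] at h
  exact (List.append_inj h (by simp)).1

/-- The list coded by `r` as the common stem of the two sequences. -/
def stem (r : ℕ → ℕ) : List ℕ := Denumerable.ofNat (List ℕ) ((r 0).unpair.1 - 1)

/-- The extension of `s` coded by `r` for the requirement `j`. -/
def extension (r : ℕ → ℕ) (j : ℕ) (s : List ℕ) : List ℕ :=
  Denumerable.ofNat (List ℕ) (r (Encodable.encode (j, s) + 1)).unpair.1

/-- One step of the simultaneous construction: each list announces the length of the next extension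
of the other one, and the second list records the next value of `r`. -/
def pairStep (r : ℕ → ℕ) (n : ℕ) (q : List ℕ × List ℕ) : List ℕ × List ℕ :=
  let t := extension r n q.1
  let v := q.2 ++ [r n, t.length]
  let t' := extension r n v
  (q.1 ++ t ++ [t'.length], v ++ t')

/-- The finite approximations of the two sequences built from `r`. -/
def pairStage (r : ℕ → ℕ) : ℕ → List ℕ × List ℕ
  | 0 => (stem r ++ [0], stem r ++ [1])
  | n + 1 => pairStep r n (pairStage r n)

/-- The first sequence built from `r`. -/
def firstPoint (r : ℕ → ℕ) : ℕ → ℕ := limitOfLists fun n => (pairStage r n).1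

/-- The second sequence built from `r`. -/
def secondPoint (r : ℕ → ℕ) : ℕ → ℕ := limitOfLists fun n => (pairStage r n).2

theorem pairStage_fst (r : ℕ → ℕ) (n : ℕ) :
    (pairStage r n).1 = initialSegment (firstPoint r) (pairStage r n).1.length := by
  refine eq_initialSegment_limitOfLists (s := fun n => (pairStage r n).1) (fun n => ?_) n
  simp only [pairStage, pairStep]
  rcases extension r n (pairStage r n).1 with _ | ⟨a, t⟩
  · exact ⟨_, [], by simp; rfl⟩
  · exact ⟨a, _, by simp; rfl⟩

theorem pairStage_snd (r : ℕ → ℕ) (n : ℕ) :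
    (pairStage r n).2 = initialSegment (secondPoint r) (pairStage r n).2.length :=
  eq_initialSegment_limitOfLists (s := fun n => (pairStage r n).2)
    (fun n => ⟨_, _, by simp only [pairStage, pairStep, List.append_assoc, List.cons_append]; rfl⟩) n

theorem initialSegment_firstPoint (r : ℕ → ℕ) :
    initialSegment (firstPoint r) (stem r).length = stem r ∧ firstPoint r (stem r).length = 0 := by
  have h := pairStage_fst r 0
  simp only [pairStage] at h
  exact ⟨(eq_initialSegment_of_append h).symm, apply_of_append_cons_eq_initialSegment h⟩

theorem initialSegment_secondPoint (r : ℕ → ℕ) :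
    initialSegment (secondPoint r) (stem r).length = stem r ∧
      secondPoint r (stem r).length = 1 := by
  have h := pairStage_snd r 0
  simp only [pairStage] at h
  exact ⟨(eq_initialSegment_of_append h).symm, apply_of_append_cons_eq_initialSegment h⟩

theorem secondPoint_length (r : ℕ → ℕ) (n : ℕ) :
    secondPoint r (pairStage r n).2.length = r n ∧
    secondPoint r ((pairStage r n).2.length + 1) = (extension r n (pairStage r n).1).length := by
  have h := pairStage_snd r (n + 1)
  nth_rw 1 [pairStage] at h
  simp only [pairStep] at h
  constructor
  · exact apply_of_append_cons_eq_initialSegment (by simpa using h)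
  · simpa using apply_of_append_cons_eq_initialSegment (s := (pairStage r n).2 ++ [r n])
      (by simpa using h)

theorem firstPoint_length (r : ℕ → ℕ) (n : ℕ) :
    firstPoint r ((pairStage r n).1.length + (extension r n (pairStage r n).1).length) +
    (pairStage r n).2.length + 2 = (pairStage r (n + 1)).2.length := by
  have h := pairStage_fst r (n + 1)
  nth_rw 1 [pairStage] at h
  simp only [pairStep] at h
  have := apply_of_append_cons_eq_initialSegment h
  rw [List.length_append] at this
  rw [this]
  simp [pairStage, pairStep]
  omega

/-- Together with `length_pairStage_succ_snd` this makes the stage lengths readable from the two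
sequences. An extension depends on everything before it in its own list, so its length cannot be
announced there in advance; the other list announces it. -/
theorem length_pairStage_succ_fst (r : ℕ → ℕ) (n : ℕ) :
    (pairStage r (n + 1)).1.length =
      (pairStage r n).1.length + secondPoint r ((pairStage r n).2.length + 1) + 1 := by
  rw [(secondPoint_length r n).2]
  simp [pairStage, pairStep]
  omega

theorem length_pairStage_succ_snd (r : ℕ → ℕ) (n : ℕ) :
    (pairStage r (n + 1)).2.length = firstPoint r ((pairStage r n).1.length +
      secondPoint r ((pairStage r n).2.length + 1)) + (pairStage r n).2.length + 2 := by
  rw [(secondPoint_length r n).2, firstPoint_length]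

theorem firstPoint_meets {r : ℕ → ℕ} {O : ℕ → Set (List ℕ)}
    (h : ∀ j s, s ++ extension r j s ∈ O j) (j : ℕ) :
    ∃ n, initialSegment (firstPoint r) n ∈ O j := by
  have h1 := pairStage_fst r (j + 1)
  nth_rw 1 [pairStage] at h1
  exact ⟨_, by rw [← eq_initialSegment_of_append h1]; exact h _ _⟩

theorem secondPoint_meets {r : ℕ → ℕ} {O : ℕ → Set (List ℕ)}
    (h : ∀ j s, s ++ extension r j s ∈ O j) (j : ℕ) :
    ∃ n, initialSegment (secondPoint r) n ∈ O j :=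
  ⟨_, by rw [← pairStage_snd r (j + 1)]; exact h _ _⟩

/-! ### Recovering r from limits of pairs -/

open Filter

theorem eventually_initialSegment_eq {ι : Type*} {l : Filter ι} {x : ι → ℕ → ℕ} {y : ℕ → ℕ}
    (h : ∀ i, ∀ᶠ k in l, x k i = y i) (n : ℕ) :
    ∀ᶠ k in l, initialSegment (x k) n = initialSegment y n := by
  have : ∀ᶠ k in l, ∀ i ∈ Set.Iio n, x k i = y i :=
    (Filter.eventually_all_finite (Set.finite_Iio n)).2 fun i _ => h i
  exact this.mono fun k hk => initialSegment_congr hk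

/-- If the two sequences built from `r k` converge to distinct limits, then `r k` converges and the
limits are built from its limit. -/
theorem exists_limit_of_points {ι : Type*} {l : Filter ι} [l.NeBot] {r : ι → ℕ → ℕ} {x y : ℕ → ℕ}
    (hx : ∀ i, ∀ᶠ k in l, firstPoint (r k) i = x i)
    (hy : ∀ i, ∀ᶠ k in l, secondPoint (r k) i = y i) (hxy : x ≠ y) :
    ∃ ρ : ℕ → ℕ, (∀ i, ∀ᶠ k in l, r k i = ρ i) ∧ x = firstPoint ρ ∧ y = secondPoint ρ := by
  classical
  -- The stem ends exactly where the two sequences first differ; since the limits differ, this place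
  -- is eventually constant.
  have hstem : ∃ m, ∀ᶠ k in l, (stem (r k)).length = m := by
    have hne : ∃ m, x m ≠ y m := Function.ne_iff.1 hxy
    refine ⟨Nat.find hne, ?_⟩
    have hbelow : ∀ i < Nat.find hne, x i = y i := fun i hi => not_not.1 (Nat.find_min hne hi)
    filter_upwards [hx (Nat.find hne), hy (Nat.find hne), eventually_initialSegment_eq hx
      (Nat.find hne), eventually_initialSegment_eq hy (Nat.find hne)] with k h1 h2 h3 h4
    obtain ⟨h5, h6⟩ := initialSegment_firstPoint (r k)
    obtain ⟨h7, h8⟩ := initialSegment_secondPoint (r k)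
    rw [initialSegment_congr hbelow, ← h4] at h3
    rcases lt_trichotomy (stem (r k)).length (Nat.find hne) with h | h | h
    · have := getElem?_initialSegment (firstPoint (r k)) h
      rw [h3, getElem?_initialSegment _ h, h6, h8] at this
      simp at this
    · exact h
    · have := getElem?_initialSegment (firstPoint (r k)) h
      rw [h5, ← h7, getElem?_initialSegment _ h, h1, h2] at this
      exact absurd (Option.some_injective _ this).symm (Nat.find_spec hne)
  have hlen : ∀ n, ∃ a b, ∀ᶠ k in l,
      (pairStage (r k) n).1.length = a ∧ (pairStage (r k) n).2.length = b := by
    intro n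
    induction n with
    | zero =>
      obtain ⟨m, hm⟩ := hstem
      exact ⟨m + 1, m + 1, hm.mono fun k hk => by simp [pairStage, hk]⟩
    | succ n ih =>
      obtain ⟨a, b, hab⟩ := ih
      refine ⟨a + y (b + 1) + 1, x (a + y (b + 1)) + b + 2, ?_⟩
      filter_upwards [hab, hy (b + 1), hx (a + y (b + 1))] with k hk h1 h2
      rw [length_pairStage_succ_fst, length_pairStage_succ_snd, hk.1, hk.2, h1, h2]
      exact ⟨rfl, rfl⟩
  choose a b hab using hlen
  -- The second sequence stores `r k i` right after its stage i, whose length is eventually `b i`.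
  have hρ : ∀ i, ∀ᶠ k in l, r k i = y (b i) := fun i => by
    filter_upwards [hab i, hy (b i)] with k h1 h2
    rw [← h2, ← h1.2, (secondPoint_length (r k) i).1]
  have hstage : ∀ n, ∀ᶠ k in l, pairStage (r k) n = pairStage (fun i => y (b i)) n := by
    have hext : ∀ j s, ∀ᶠ k in l, extension (r k) j s = extension (fun i => y (b i)) j s :=
      fun j s => (hρ _).mono fun k hk => by rw [extension, hk]; rfl
    intro n
    induction n with
    | zero => exact (hρ 0).mono fun k hk => by simp only [pairStage, stem, hk]
    | succ n ih =>
      filter_upwards [ih, hρ n, hext n (pairStage (fun i => y (b i)) n).1, hext n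
        ((pairStage (fun i => y (b i)) n).2 ++ [y (b n),
          (extension (fun i => y (b i)) n (pairStage (fun i => y (b i)) n).1).length])]
        with k h1 h2 h3 h4
      simp only [pairStage, pairStep, h1, h2, h3, h4]
  refine ⟨fun i => y (b i), hρ, funext fun i => ?_, funext fun i => ?_⟩
  · obtain ⟨k, h1, h2⟩ := ((hx i).and (hstage (i + 1))).exists
    rw [← h1, firstPoint, firstPoint, limitOfLists, limitOfLists, h2]
  · obtain ⟨k, h1, h2⟩ := ((hy i).and (hstage (i + 1))).exists
    rw [← h1, secondPoint, secondPoint, limitOfLists, limitOfLists, h2]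

/-! ### Joining two points in each covered section -/

theorem exists_measurable_selection {E : Type*} [MeasurableSpace E] {S : ℕ → ℕ → Set E}
    (hS : ∀ i n, MeasurableSet (S i n)) (hex : ∀ i e, ∃ n, e ∈ S i n) :
    ∃ g : E → ℕ → ℕ, Measurable g ∧ ∀ e i, e ∈ S i (g e i) := by
  classical
  exact ⟨fun e i => Nat.find (hex i e),
    measurable_pi_lambda _ fun i => measurable_find (hex i) (hS i),
    fun e i => Nat.find_spec (hex i e)⟩

/-- Codes for the construction of a pair of generic sequences with a common stem in `W`. -/
theorem exists_isClosed_graph_code {W : List ℕ → Set (ℕ → ℕ)} {O : ℕ → List ℕ → Set (ℕ → ℕ)}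
    (hW : ∀ s, MeasurableSet (W s)) (hO : ∀ j s, MeasurableSet (O j s))
    (hd : ∀ j e s, ∃ t, e ∈ O j (s ++ t)) :
    ∃ r : (ℕ → ℕ) → ℕ → ℕ, IsClosed {q : (ℕ → ℕ) × (ℕ → ℕ) | q.2 = r q.1} ∧
      Measurable (fun e => (stem (r e)).length) ∧
      (∀ e s, e ∈ W s → (r e 0).unpair.1 ≠ 0) ∧
      (∀ e, (r e 0).unpair.1 ≠ 0 → e ∈ W (stem (r e))) ∧
      ∀ e j s, e ∈ O j (s ++ extension (r e) j s) := by
  -- Entry 0 of the selection is 0 if no list lies in `W`, and otherwise one more than the code of a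
  -- list in `W`; `stem` undoes the shift. Entry i + 1 codes an extension for the i-th pair of a
  -- requirement and a list.
  let S : ℕ → ℕ → Set (ℕ → ℕ) := fun i n =>
    Nat.casesOn i (Nat.casesOn n (⋂ s, (W s)ᶜ) fun n => W (Denumerable.ofNat (List ℕ) n))
      fun i => O (Denumerable.ofNat (ℕ × List ℕ) i).1
        ((Denumerable.ofNat (ℕ × List ℕ) i).2 ++ Denumerable.ofNat (List ℕ) n)
  have hS : ∀ i n, MeasurableSet (S i n) := by
    rintro (_ | i) n
    · rcases n with _ | n
      · exact MeasurableSet.iInter fun s => (hW s).compl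
      · exact hW _
    · exact hO _ _
  have hex : ∀ i e, ∃ n, e ∈ S i n := by
    rintro (_ | i) e
    · by_cases h : ∃ s, e ∈ W s
      · obtain ⟨s, hs⟩ := h
        exact ⟨Encodable.encode s + 1, by simpa [S] using hs⟩
      · exact ⟨0, by simpa [S] using h⟩
    · obtain ⟨t, ht⟩ := hd (Denumerable.ofNat (ℕ × List ℕ) i).1 e
        (Denumerable.ofNat (ℕ × List ℕ) i).2
      exact ⟨Encodable.encode t, by simpa [S] using ht⟩
  obtain ⟨g, hg, hgS⟩ := exists_measurable_selection hS hex
  obtain ⟨r, hr, hrg⟩ := exists_isClosed_graph_unpair hg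
  refine ⟨r, hr, ?_, ?_, ?_, ?_⟩
  · have : (fun e => (stem (r e)).length) =
        (fun n => (Denumerable.ofNat (List ℕ) (n - 1)).length) ∘ fun e => g e 0 := by
      ext e
      simp [stem, hrg]
    rw [this]
    exact measurable_from_top.comp ((measurable_pi_apply 0).comp hg)
  · intro e s hs h0
    have := hgS e 0
    rw [← hrg, h0] at this
    exact Set.mem_iInter.1 this s hs
  · intro e h0
    have := hgS e 0
    rw [← hrg] at this
    obtain ⟨n, hn⟩ := Nat.exists_eq_succ_of_ne_zero h0
    simp only [stem, hn] at this ⊢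
    exact this
  · intro e j s
    have := hgS e (Encodable.encode (j, s) + 1)
    rw [← hrg] at this
    simpa [S, extension] using this

/-- Given countably many Borel sets `A k`, there is a partial injection with locally closed graph,
acting on the sections, with a measurable `2`-coloring, that joins two points of the same `A k` in
each section covered by the `A k`. -/
theorem exists_graph_joining_points (A : ℕ → Set ((ℕ → ℕ) × (ℕ → ℕ)))
    (hA : ∀ k, MeasurableSet (A k)) :
    ∃ (D : Set (ℕ → ℕ)) (f g : (ℕ → ℕ) → ℕ → ℕ) (c : (ℕ → ℕ) × (ℕ → ℕ) → Fin 2),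
      Measurable c ∧ (∀ e, c (e, f e) = 0) ∧ (∀ e, c (e, g e) = 1) ∧
      IsClosed ({q : ((ℕ → ℕ) × (ℕ → ℕ)) × ((ℕ → ℕ) × (ℕ → ℕ)) |
        ∃ e ∈ D, q = ((e, f e), (e, g e))} ∪ {q | q.1 = q.2}) ∧
      ∀ e, (∀ x, ∃ k, (e, x) ∈ A k) → e ∈ D ∧ ∃ k, (e, f e) ∈ A k ∧ (e, g e) ∈ A k := by
  classical
  choose W O hW hO hup hd hWO using fun k => (hA k).hasUniformBaireProperty
  obtain ⟨r, hr, hm, hr0, hrW, hrO⟩ := exists_isClosed_graph_code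
    (W := fun s => ⋃ k, W k s) (O := fun j s => O j.unpair.1 j.unpair.2 s)
    (fun s => MeasurableSet.iUnion fun k => hW k s) (fun j s => hO _ _ s) (fun j e s => hd _ _ e s)
  have hmeet : ∀ e x, (∀ j : ℕ, ∃ n, initialSegment x n ∈
      {s | e ∈ O j.unpair.1 j.unpair.2 s}) → ∀ k, (e, x) ∈ A k ↔
        ∃ n, e ∈ W k (initialSegment x n) := fun e x h k =>
    hWO k e x fun j => by simpa using h (Nat.pair k j)
  refine ⟨{e | (r e 0).unpair.1 ≠ 0}, fun e => firstPoint (r e), fun e => secondPoint (r e),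
    fun z => if z.2 (stem (r z.1)).length = 0 then 0 else 1, ?_, ?_, ?_, ?_, ?_⟩
  · refine Measurable.ite ?_ measurable_const measurable_const
    have : {z : (ℕ → ℕ) × (ℕ → ℕ) | z.2 (stem (r z.1)).length = 0} =
        ⋃ m, {z | (stem (r z.1)).length = m} ∩ {z | z.2 m = 0} := by
      ext z
      simp
    rw [this]
    exact MeasurableSet.iUnion fun m => (measurableSet_eq_fun (hm.comp measurable_fst)
      measurable_const).inter (measurableSet_eq_fun ((measurable_pi_apply m).comp measurable_snd)
        measurable_const)
  · intro e
    simp [(initialSegment_firstPoint (r e)).2]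
  · intro e
    simp [(initialSegment_secondPoint (r e)).2]
  -- The diagonal absorbs the limits at which the two endpoints merge, so only distinct limits need
  -- decoding.
  · refine IsSeqClosed.isClosed fun z q hz hq => ?_
    by_cases hne : q.1 = q.2
    · exact Or.inr hne
    refine Or.inl ?_
    have hev : ∀ᶠ k in atTop, ∃ e, (r e 0).unpair.1 ≠ 0 ∧
        z k = ((e, firstPoint (r e)), (e, secondPoint (r e))) := by
      have : ∀ᶠ k in atTop, (z k).1 ≠ (z k).2 :=
        hq.eventually ((isOpen_ne_fun continuous_fst continuous_snd).mem_nhds hne)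
      exact this.mono fun k hk => (hz k).resolve_right hk
    have hev' : ∀ᶠ k in atTop, (r (z k).1.1 0).unpair.1 ≠ 0 ∧ (z k).2.1 = (z k).1.1 ∧
        firstPoint (r (z k).1.1) = (z k).1.2 ∧ secondPoint (r (z k).1.1) = (z k).2.2 := by
      filter_upwards [hev] with k hk
      obtain ⟨e, he, hk⟩ := hk
      simp [hk, he]
    have hlim : ∀ φ : ((ℕ → ℕ) × (ℕ → ℕ)) × ((ℕ → ℕ) × (ℕ → ℕ)) → ℕ, Continuous φ →
        ∀ᶠ k in atTop, φ (z k) = φ q := fun φ hφ =>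
      ((hφ.tendsto q).comp hq).eventually (p := fun n => n = φ q) (by simp [nhds_discrete])
    have heq : q.2.1 = q.1.1 := by
      ext i
      obtain ⟨k, h1, h2, h3⟩ := (hev'.and ((hlim (fun q => q.2.1 i) (by fun_prop)).and
        (hlim (fun q => q.1.1 i) (by fun_prop)))).exists
      rw [← h2, ← h3, h1.2.1]
    have hne' : q.1.2 ≠ q.2.2 := fun h => hne (Prod.ext heq.symm h)
    obtain ⟨ρ, hρ, h1, h2⟩ := exists_limit_of_points (l := atTop) (r := fun k => r (z k).1.1)
      (fun i => by
        filter_upwards [hev', hlim (fun q => q.1.2 i) (by fun_prop)] with k h1 h2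
        rw [h1.2.2.1, h2])
      (fun i => by
        filter_upwards [hev', hlim (fun q => q.2.2 i) (by fun_prop)] with k h1 h2
        rw [h1.2.2.2, h2]) hne'
    have hρr : ρ = r q.1.1 := by
      have ht : Tendsto (fun k => ((z k).1.1, r (z k).1.1)) atTop (nhds (q.1.1, ρ)) := by
        refine Tendsto.prodMk_nhds ?_ ?_
        · exact ((continuous_fst.comp continuous_fst).tendsto q).comp hq
        · exact tendsto_pi_nhds.2 fun i => tendsto_nhds_of_eventually_eq (hρ i)
      exact hr.mem_of_tendsto ht (Eventually.of_forall fun k => rfl)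
    refine ⟨q.1.1, ?_, ?_⟩
    · obtain ⟨k, h3, h4⟩ := (hev'.and (hρ 0)).exists
      change (r q.1.1 0).unpair.1 ≠ 0
      rw [← hρr, ← h4]
      exact h3.1
    · beta_reduce
      rw [← hρr, ← h1, ← h2]
      exact Prod.ext rfl (Prod.ext heq rfl)
  · intro e he
    have hf := hmeet e _ (firstPoint_meets (hrO e))
    have hg := hmeet e _ (secondPoint_meets (hrO e))
    -- The generic point `firstPoint (r e)` lies in some `A k`, so a neighbourhood in `W k` exists.
    have hD : (r e 0).unpair.1 ≠ 0 := by
      obtain ⟨k, hk⟩ := he (firstPoint (r e))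
      obtain ⟨n, hn⟩ := (hf k).1 hk
      exact hr0 e _ (Set.mem_iUnion.2 ⟨k, hn⟩)
    -- One k serves for the common stem, hence for both points.
    obtain ⟨k, hk⟩ := Set.mem_iUnion.1 (hrW e hD)
    exact ⟨hD, k, (hf k).2 ⟨_, by rw [(initialSegment_firstPoint (r e)).1]; exact hk⟩,
      (hg k).2 ⟨_, by rw [(initialSegment_secondPoint (r e)).1]; exact hk⟩⟩

/-! ### The diagonal argument -/

/-- The Baire space is homeomorphic to its square. -/
def bairePairing : (ℕ → ℕ) × (ℕ → ℕ) ≃ₜ (ℕ → ℕ) :=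
  Homeomorph.sumArrowHomeomorphProdArrow.symm.trans
    (Homeomorph.piCongrLeft (Y := fun _ => ℕ) Equiv.natSumNatEquivNat)

theorem theorem1p2 (ξ : Ordinal.{0}) (hξ_one : 1 ≤ ξ) (hξ_lt : ξ < Ordinal.omega 1) :
    ∃ i : (ℕ → ℕ) →. (ℕ → ℕ),
      IsPartialInjection i ∧
      Disjoint i.Dom i.ran ∧
      (∃ C D : Set ((ℕ → ℕ) × (ℕ → ℕ)), IsClosed C ∧ IsClosed D ∧ i.graph = C \ D) ∧
      (∃ c : (ℕ → ℕ) → Fin 2, Measurable c ∧ IsColoring i.graph c) ∧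
      ¬ ∃ c : (ℕ → ℕ) → ℕ, IsDelta0Measurable ξ c ∧ IsColoring i.graph c := by
  obtain ⟨U, hU, hUξ⟩ := exists_measurableSet_isUniversalFor_isSigma0 hξ_lt
  let h := bairePairing
  -- Here e plays two roles: first coordinate of the point and, through its k-th row, code of the
  -- k-th set tested at that point.
  let A : ℕ → Set ((ℕ → ℕ) × (ℕ → ℕ)) := fun k =>
    {z | ((fun n => z.1 (Nat.pair k n)), h z) ∈ U}
  have hA : ∀ k, MeasurableSet (A k) := fun k => by
    refine (Measurable.prodMk (measurable_pi_lambda _ fun n => ?_) h.continuous.measurable) hU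
    exact (measurable_pi_apply (Nat.pair k n)).comp measurable_fst
  obtain ⟨D, f, g, c, hc, hcf, hcg, hclosed, hjoin⟩ := exists_graph_joining_points A hA
  have hfg : ∀ e e', (e, f e) ≠ (e', g e') := fun e e' heq => by
    have := hcf e
    rw [heq, hcg] at this
    exact one_ne_zero this
  let i : (ℕ → ℕ) →. (ℕ → ℕ) := fun z =>
    ⟨(h.symm z).1 ∈ D ∧ (h.symm z).2 = f (h.symm z).1,
      fun _ => h ((h.symm z).1, g (h.symm z).1)⟩
  have hi : ∀ z w, w ∈ i z ↔ ∃ e ∈ D, z = h (e, f e) ∧ w = h (e, g e) := by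
    intro z w
    constructor
    · rintro ⟨⟨h1, h2⟩, rfl⟩
      exact ⟨(h.symm z).1, h1, by rw [← h2]; simp, rfl⟩
    · rintro ⟨e, he, rfl, rfl⟩
      exact ⟨by simpa [i] using he, by simp [i]⟩
  have hgraph : ∀ z w, (z, w) ∈ i.graph ↔ ∃ e ∈ D, z = h (e, f e) ∧ w = h (e, g e) := hi
  refine ⟨i, ?_, ?_, ?_, ?_, ?_⟩
  · intro x x' y hx hx'
    obtain ⟨e, -, rfl, rfl⟩ := (hi _ _).1 hx
    obtain ⟨e', -, rfl, hy⟩ := (hi _ _).1 hx'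
    obtain rfl : e = e' := (Prod.ext_iff.1 (h.injective hy)).1
    rfl
  · rw [Set.disjoint_left]
    rintro z hz ⟨y, hy⟩
    obtain ⟨w, hw⟩ := (PFun.mem_dom i z).1 hz
    obtain ⟨e, -, rfl, -⟩ := (hi _ _).1 hw
    obtain ⟨e', -, -, he'⟩ := (hi _ _).1 hy
    exact hfg e e' (h.injective he')
  · refine ⟨_, {q | q.1 = q.2}, hclosed.preimage (h.symm.prodCongr h.symm).continuous,
      isClosed_eq continuous_fst continuous_snd, ?_⟩
    ext ⟨z, w⟩
    rw [hgraph]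
    constructor
    · rintro ⟨e, he, rfl, rfl⟩
      exact ⟨Or.inl ⟨e, he, by simp⟩, fun heq => hfg e e (h.injective heq)⟩
    · rintro ⟨⟨e, he, heq⟩ | heq, hne⟩
      · obtain ⟨h1, h2⟩ := Prod.ext_iff.1 heq
        exact ⟨e, he, h.symm_apply_eq.1 h1, h.symm_apply_eq.1 h2⟩
      · exact absurd (h.symm.injective heq) hne
  · refine ⟨c ∘ h.symm, hc.comp h.symm.continuous.measurable, fun z w hzw => ?_⟩
    obtain ⟨e, -, rfl, rfl⟩ := (hgraph _ _).1 hzw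
    simp [hcf, hcg]
  · rintro ⟨χ, hχ, hcol⟩
    choose ε hε using fun k => hUξ (χ ⁻¹' {k}) (hχ {k} (isOpen_discrete _)).1
    -- A single parameter whose rows code all the colour classes of χ; on its section the sets `A k`
    -- are exactly these classes.
    let e : ℕ → ℕ := fun n => ε n.unpair.1 n.unpair.2
    have he : ∀ x k, (e, x) ∈ A k ↔ χ (h (e, x)) = k := by
      intro x k
      have : h (e, x) ∈ χ ⁻¹' {k} ↔ (ε k, h (e, x)) ∈ U := by
        conv_lhs => rw [hε k]
        rfl
      simp only [Set.mem_preimage, Set.mem_singleton_iff] at this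
      rw [this]
      simp [A, e]
    obtain ⟨heD, k, h1, h2⟩ := hjoin e fun x => ⟨_, (he x _).2 rfl⟩
    exact hcol _ _ ((hgraph _ _).2 ⟨e, heD, rfl, rfl⟩)
      (((he _ _).1 h1).trans ((he _ _).1 h2).symm)
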